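/- **Proposition 3.2.** There is an absolute constant $C$ such that the following holds. Let $K=\mathbf F_q$ be a finite field, and let $\mathrm{P\Gamma L}_3(K)=\Gamma\mathrm{L}_3(K)/Z$ be the projective semilinear group, where $\Gamma\mathrm L_3(K)=\mathrm{GL}_3(K)\rtimes\mathrm{Gal}(K)$, $\mathrm{Gal}(K)$ is the Galois group of $K$ over its prime subfield (acting entrywise on $\mathrm{GL}_3(K)$), and $Z$ is the group of nonzero scalar matrices. Identify $\mathrm{PGL}_3(K)=\mathrm{GL}_3(K)/Z$ with its image in $\mathrm{P\Gamma L}_3(K)$. If $G$ is an abelian subgroup of $\mathrm{P\Gamma L}_3(K)$ that is not contained in $\mathrm{PGL}_3(K)$, then $|G|\le C\,q$. -/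

import Mathlib

/-- The entrywise action of the field automorphisms of `K` on `GL_n(K)`. For a finite field `K`,
`RingAut K` is the Galois group of `K` over its prime subfield: every ring automorphism fixes the
prime subfield. -/
def galoisActionGL (n : ℕ) (K : Type*) [Field K] :
    RingAut K →* MulAut (Matrix.GeneralLinearGroup (Fin n) K) where
  toFun σ := Units.mapEquiv σ.mapMatrix.toMulEquiv
  map_one' := by ext g i j; rfl
  map_mul' σ τ := by ext g i j; rfl

/-- The general semilinear group `ΓL_n(K) = GL_n(K) ⋊ Gal(K)`: the pair `(g, σ)` stands for the
semilinear bijection `v ↦ g (σ v)` of `K ^ n`, where `σ` acts on the coordinates. -/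
abbrev GammaL (n : ℕ) (K : Type*) [Field K] : Type _ :=
  Matrix.GeneralLinearGroup (Fin n) K ⋊[galoisActionGL n K] RingAut K

/-- The subgroup of scalar matrices, i.e. the centre of `GL_n(K)`, inside `ΓL_n(K)`. -/
def scalarSubgroup (n : ℕ) (K : Type*) [Field K] : Subgroup (GammaL n K) :=
  (Subgroup.center (Matrix.GeneralLinearGroup (Fin n) K)).map SemidirectProduct.inl

instance scalarSubgroup_normal (n : ℕ) (K : Type*) [Field K] : (scalarSubgroup n K).Normal := by
  refine ⟨?_⟩
  rintro _ ⟨z, hz, rfl⟩ x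
  refine ⟨galoisActionGL n K x.right z, ?_, ?_⟩
  · exact Subgroup.mem_center_iff.mpr fun g => by
      have h := Subgroup.mem_center_iff.mp hz ((galoisActionGL n K x.right).symm g)
      simpa using congrArg (galoisActionGL n K x.right) h
  · have hc : ∀ g, g * galoisActionGL n K x.right z = galoisActionGL n K x.right z * g := fun g => by
      have h := Subgroup.mem_center_iff.mp hz ((galoisActionGL n K x.right).symm g)
      simpa using congrArg (galoisActionGL n K x.right) h
    apply SemidirectProduct.ext
    · simp [hc]
    · simp

/-- The projective semilinear group `PΓL_n(K)`: the quotient of `ΓL_n(K)` by the scalars. -/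
abbrev PGammaL (n : ℕ) (K : Type*) [Field K] : Type _ :=
  GammaL n K ⧸ scalarSubgroup n K

/-- `PGL_n(K) = GL_n(K) / scalars` as a subgroup of `PΓL_n(K)`: the image of `GL_n(K)`. -/
def projectiveLinearSubgroup (n : ℕ) (K : Type*) [Field K] : Subgroup (PGammaL n K) :=
  ((QuotientGroup.mk' (scalarSubgroup n K)).comp
    (SemidirectProduct.inl : Matrix.GeneralLinearGroup (Fin n) K →* GammaL n K)).range

/-! Let Γ be the image of G in Gal(K), r ≥ 2 its order, σ a generator and F its fixed field, so q =
|F|^r. Put H = G ∩ PGL_3, with preimage P in GL_3, and fix gσ in G above σ. Elements of P commute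
with gσ up to scalars. Taking determinants, a subgroup Q of index at most 3 in P consists of
matrices having a multiple fixed by x ↦ g σ(x) g⁻¹. Either Q is abelian and spans dimension at most
3 (`finrank_le_three_of_commute`), or ab = cba in Q with c ≠ 1, and the centralizer of a has index
at most 3 in Q and lies in a space of dimension at most 3 (`finrank_centralizer_le_three`). Such a
space has at most |F|³ fixed points (`card_le_pow_of_semilinear_fixed`), whence |H| ≤ 9|F|³/(|F| -
1) ≤ 18|F|². Since |G| = r|H| and r ≤ 2|F|^(r-2), the bound 36q follows. -/

/-! ### Dimensions of commuting matrix algebras -/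

open Module in
/-- A commutative algebra of endomorphisms of a space of dimension `3` has dimension at most `3`. -/
theorem finrank_le_three_of_commute {K V : Type*} [Field K] [AddCommGroup V] [Module K V]
    (hV : finrank K V = 3) (B : Subalgebra K (Module.End K V))
    (hB : ∀ a ∈ B, ∀ b ∈ B, Commute a b) : finrank K B ≤ 3 := by
  have : FiniteDimensional K V := .of_finrank_pos (by omega)
  let ev : V → (B →ₗ[K] V) := fun v => (LinearMap.applyₗ v).comp B.toSubmodule.subtype
  have hev : ∀ v (b : B), ev v b = b.1 v := fun v b => rfl
  have hcomm : ∀ (a b : B) (v : V), a.1 (b.1 v) = b.1 (a.1 v) := fun a b v =>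
    LinearMap.congr_fun (hB a.1 a.2 b.1 b.2) v
  have hrn : ∀ v, finrank K (LinearMap.range (ev v)) + finrank K (LinearMap.ker (ev v)) =
      finrank K B := fun v => LinearMap.finrank_range_add_finrank_ker _
  have hle : ∀ v, finrank K (LinearMap.range (ev v)) ≤ 3 := fun v =>
    hV ▸ Submodule.finrank_le _
  -- Case split on the largest dimension of an orbit Bv. If Bv = V, an element killing v kills every
  -- cv, so evaluation at v is injective.
  by_cases h3 : ∃ v, finrank K (LinearMap.range (ev v)) = 3
  · obtain ⟨v, hv⟩ := h3
    have htop : LinearMap.range (ev v) = ⊤ := Submodule.eq_top_of_finrank_eq (by rw [hv, hV])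
    have hker : LinearMap.ker (ev v) = ⊥ := by
      rw [LinearMap.ker_eq_bot']
      intro b hb
      ext w
      obtain ⟨c, rfl⟩ := LinearMap.range_eq_top.mp htop w
      rw [hev] at hb ⊢
      simp [hcomm b c v, hb]
    have := hrn v
    rw [hker, finrank_bot] at this
    omega
  by_cases h2 : ∃ v, finrank K (LinearMap.range (ev v)) = 2
  · obtain ⟨v, hv⟩ := h2
    set W := LinearMap.range (ev v) with hW
    set N := LinearMap.ker (ev v) with hN
    have hne : W ≠ ⊤ := fun h => by rw [h, finrank_top, hV] at hv; omega
    obtain ⟨e, -, he⟩ := SetLike.exists_of_lt (lt_top_iff_ne_top.mpr hne)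
    have hlt3 : ∀ U : Submodule K V, W ≤ U → e ∈ U → finrank K U = 3 := by
      intro U hWU heU
      have h1 := Submodule.finrank_lt_finrank_of_lt
        (lt_of_le_of_ne hWU (fun h => he (h ▸ heU)))
      have h2 := Submodule.finrank_le U
      omega
    have hkill : ∀ b ∈ N, ∀ w ∈ W, b.1 w = 0 := by
      rintro b hb _ ⟨c, rfl⟩
      have hb' : b.1 v = 0 := hb
      rw [hev, hcomm, hb', map_zero]
    have hinj : Function.Injective ((ev e).domRestrict N) := by
      rw [injective_iff_map_eq_zero]
      rintro ⟨b, hb⟩ hbe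
      have hbe' : b.1 e = 0 := hbe
      have hker := hlt3 (LinearMap.ker b.1) (fun w hw => hkill b hb w hw) hbe'
      have hk : LinearMap.ker b.1 = ⊤ := Submodule.eq_top_of_finrank_eq (by rw [hker, hV])
      ext w
      simpa using (hk ▸ Submodule.mem_top : w ∈ LinearMap.ker b.1)
    -- If n e = e with n v = 0, then n sends v + e to e and b - bn sends it to bv, so v + e has a
    -- full orbit, which is excluded. Hence Ne is a proper subspace of Be, and dim N ≤ 1.
    have hNe : e ∉ LinearMap.range ((ev e).domRestrict N) := by
      rintro ⟨⟨n, hn⟩, hne⟩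
      have hne' : n.1 e = e := hne
      have hnv : n.1 v = 0 := hn
      refine h3 ⟨v + e, hlt3 _ ?_ ⟨n, ?_⟩⟩
      · rintro _ ⟨b, rfl⟩
        refine ⟨b - b * n, ?_⟩
        simp [hev, hnv, hne']
      · simp [hev, hnv, hne']
    have hlt : LinearMap.range ((ev e).domRestrict N) < LinearMap.range (ev e) := by
      refine lt_of_le_of_ne ?_ fun h => hNe (h ▸ ⟨1, rfl⟩)
      rintro _ ⟨n, rfl⟩
      exact ⟨n.1, rfl⟩
    have h4 := Submodule.finrank_lt_finrank_of_lt hlt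
    rw [LinearMap.finrank_range_of_inj hinj] at h4
    have h5 := hle e
    have h6 : finrank K (LinearMap.range (ev e)) ≠ 3 := fun h => h3 ⟨e, h⟩
    have h7 : finrank K W + finrank K N = finrank K B := hrn v
    omega
  · have h1 : ∀ v, finrank K (LinearMap.range (ev v)) ≤ 1 := by
      intro v
      have h5 := hle v
      have h6 : finrank K (LinearMap.range (ev v)) ≠ 3 := fun h => h3 ⟨v, h⟩
      have h7 : finrank K (LinearMap.range (ev v)) ≠ 2 := fun h => h2 ⟨v, h⟩
      omega
    let β := Module.finBasisOfFinrankEq K V hV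
    let f : B →ₗ[K] ((i : Fin 3) → LinearMap.range (ev (β i))) :=
      LinearMap.pi fun i => (ev (β i)).rangeRestrict
    have hf : Function.Injective f := by
      rw [← LinearMap.ker_eq_bot, LinearMap.ker_eq_bot']
      intro b hb
      ext1
      refine β.ext fun i => ?_
      exact congrArg Subtype.val (congrFun hb i)
    refine (LinearMap.finrank_le_finrank_of_injective hf).trans ?_
    rw [Module.finrank_pi_fintype]
    exact (Finset.sum_le_sum fun i _ => h1 (β i)).trans (by simp)

open Module in
/-- If `h h' = c h' h` for invertible `3 × 3` matrices with `c ≠ 1`, then the centralizer of `h` in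
the matrix algebra has dimension at most `3`. -/
theorem finrank_centralizer_le_three {K : Type*} [Field K] (h h' : Matrix (Fin 3) (Fin 3) K)
    (hh : IsUnit h) (hh' : IsUnit h') {c : K} (hc : c ≠ 1) (hcomm : h * h' = c • (h' * h)) :
    finrank K (Subalgebra.centralizer K {h}) ≤ 3 := by
  have hc3 : c ^ 3 = 1 := by
    have := congrArg Matrix.det hcomm
    rw [Matrix.det_smul, Matrix.det_mul, Matrix.det_mul, mul_comm h'.det, Fintype.card_fin] at this
    have hu : h.det * h'.det ≠ 0 := mul_ne_zero ((Matrix.isUnit_iff_isUnit_det h).mp hh).ne_zero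
      ((Matrix.isUnit_iff_isUnit_det h').mp hh').ne_zero
    exact (mul_right_cancel₀ hu (by rw [one_mul]; exact this)).symm
  have hc1 : c + 1 ≠ 0 := by
    intro h0
    have h1 : c = -1 := by linear_combination h0
    rw [h1] at hc3 hc
    exact hc (by linear_combination hc3)
  set C := Subalgebra.centralizer K {h} with hC
  -- C, h'C and h'²C lie in the eigenspaces of conjugation by h for 1, c, c², which are distinct; so
  -- 3 dim C ≤ 9.
  let f : (C × C × C) →ₗ[K] Matrix (Fin 3) (Fin 3) K :=
    { toFun := fun x => x.1.1 + h' * x.2.1.1 + h' * h' * x.2.2.1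
      map_add' := fun x y => by simp only [Prod.fst_add, Prod.snd_add, Subalgebra.coe_add]; noncomm_ring
      map_smul' := fun a x => by simp }
  have hmem : ∀ x : C, x.1 * h = h * x.1 := fun x =>
    ((Subalgebra.mem_centralizer_iff K).mp x.2 h rfl).symm
  have hstep : ∀ x y z : Matrix (Fin 3) (Fin 3) K, x * h = h * x → h * y = c • (y * h) →
      h * z = c ^ 2 • (z * h) → x + y + z = 0 → x = 0 ∧ y = 0 ∧ z = 0 := by
    intro x y z hx hy hz h0
    have key : ∀ u : Matrix (Fin 3) (Fin 3) K, u * h = 0 → u = 0 := fun u hu =>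
      hh.mul_left_eq_zero.mp hu
    have e1 : x + c • y + c ^ 2 • z = 0 := by
      apply key
      rw [add_mul, add_mul, smul_mul_assoc, smul_mul_assoc, hx, ← hy, ← hz, ← mul_add, ← mul_add,
        h0, mul_zero]
    have e2 : x + c ^ 2 • y + c ^ 4 • z = 0 := by
      apply key
      rw [add_mul, add_mul, smul_mul_assoc, smul_mul_assoc, hx, pow_two, mul_smul, ← hy,
        show c ^ 4 = c ^ 2 * c ^ 2 by ring, mul_smul, ← hz, ← mul_smul_comm, ← mul_smul_comm,
        ← mul_add, ← mul_add, e1, mul_zero]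
    have hz0 : z = 0 := by
      have : ((c - 1) ^ 2 * c * (c + 1)) • z = 0 := by
        -- The polynomial (X - 1)(X - c), applied to conjugation by h, kills x and y.
        have : ((c - 1) ^ 2 * c * (c + 1)) • z = (x + c ^ 2 • y + c ^ 4 • z)
          - (c + 1) • (x + c • y + c ^ 2 • z) + c • (x + y + z) := by module
        rw [this, e2, e1, h0]; simp
      refine (smul_eq_zero.mp this).resolve_left ?_
      have hc0 : c ≠ 0 := by rintro rfl; simp at hc3
      exact mul_ne_zero (mul_ne_zero (pow_ne_zero _ (sub_ne_zero.mpr hc)) hc0) hc1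
    subst hz0
    have hy0 : y = 0 := by
      have : (c - 1) • y = 0 := by
        have : (c - 1) • y = (x + c • y + c ^ 2 • (0 : Matrix (Fin 3) (Fin 3) K)) - (x + y + 0) := by
          module
        rw [this, e1, h0]; simp
      exact (smul_eq_zero.mp this).resolve_left (sub_ne_zero.mpr hc)
    subst hy0
    exact ⟨by simpa using h0, rfl, rfl⟩
  have hf : Function.Injective f := by
    rw [← LinearMap.ker_eq_bot, LinearMap.ker_eq_bot']
    rintro ⟨x, y, z⟩ h0
    have hy : h * (h' * y.1) = c • (h' * y.1 * h) := by
      rw [← mul_assoc, hcomm, mul_assoc h', hmem y, smul_mul_assoc, mul_assoc]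
    have hz : h * (h' * h' * z.1) = c ^ 2 • (h' * h' * z.1 * h) := by
      rw [mul_assoc _ z.1 h, hmem z, mul_assoc h' h', ← mul_assoc h, hcomm, smul_mul_assoc,
        mul_assoc h' h, ← mul_assoc h h', hcomm, pow_two, mul_smul]
      simp only [smul_mul_assoc, mul_smul_comm, mul_assoc]
    obtain ⟨hx0, hy0, hz0⟩ := hstep _ _ _ (hmem x) hy hz h0
    refine Prod.ext (Subtype.ext hx0) (Prod.ext (Subtype.ext ?_) (Subtype.ext ?_))
    · exact hh'.mul_right_eq_zero.mp hy0
    · exact (hh'.mul hh').mul_right_eq_zero.mp hz0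
  have h9 := LinearMap.finrank_le_finrank_of_injective hf
  simp [Module.finrank_prod, Module.finrank_matrix] at h9
  omega

/-! ### Counting lemmas -/

open Module in
/-- The fixed points of a `σ`-semilinear map inside a space spanned by fixed points form a space of
the same dimension over the fixed field of `σ`. -/
theorem card_le_pow_of_semilinear_fixed {K M : Type*} [Field K] [Finite K] [AddCommGroup M]
    [Module K M] [Module.Finite K M] (F : Subfield K) (σ : RingAut K) (hF : ∀ x, x ∈ F ↔ σ x = x)
    (T : M →+ M) (hT : ∀ (c : K) (x : M), T (c • x) = σ c • T x) (S : Set M)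
    (hS : ∀ x ∈ S, T x = x) {d : ℕ} (hd : finrank K (Submodule.span K S) ≤ d) :
    Nat.card S ≤ Nat.card F ^ d := by
  obtain ⟨b, hbS, hspan, hli⟩ := exists_linearIndependent K S
  have : Fintype b := hli.setFinite.fintype
  have hcard : Fintype.card b ≤ d := by
    rwa [← hspan, finrank_span_set_eq_card hli, Set.toFinset_card] at hd
  have hcoord : ∀ x : S, ∃ a : b → F, x.1 = ∑ i, (a i).1 • i.1 := by
    intro x
    have hx : x.1 ∈ Submodule.span K (Set.range (Subtype.val : b → M)) := by
      rw [Subtype.range_coe, hspan]; exact Submodule.subset_span x.2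
    obtain ⟨a, ha⟩ := (Submodule.mem_span_range_iff_exists_fun K).mp hx
    -- The basis consists of fixed vectors, so `T` acts on coordinates by σ; uniqueness puts the
    -- coordinates of a fixed vector in F.
    have h1 : ∑ i, (σ (a i) - a i) • i.1 = 0 := by
      have hTx := hS x.1 x.2
      rw [← ha, map_sum] at hTx
      simp only [hT, hS _ (hbS (Subtype.coe_prop _))] at hTx
      simp only [sub_smul, Finset.sum_sub_distrib, hTx, sub_self]
    have h2 := Fintype.linearIndependent_iff.mp hli _ h1
    exact ⟨fun i => ⟨a i, (hF _).mpr (sub_eq_zero.mp (h2 i))⟩, ha.symm⟩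
  choose a ha using hcoord
  have hinj : Function.Injective a := fun x y hxy => Subtype.ext (by rw [ha x, ha y, hxy])
  refine (Nat.card_le_card_of_injective a hinj).trans ?_
  rw [Nat.card_fun, Nat.card_eq_fintype_card (α := b)]
  exact Nat.pow_le_pow_right Nat.card_pos hcard

/-- `f` separates the left cosets of A ∩ B in A. It need not be a homomorphism, so an index can be
bounded by the number of values of a scalar invariant. -/
theorem card_le_card_mul_of_fibers {Γ X : Type*} [Group Γ] [Finite Γ] [Finite X]
    (A B : Subgroup Γ) (f : A → X) (hf : ∀ a b : A, f a = f b → (a : Γ)⁻¹ * b ∈ B) :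
    Nat.card A ≤ Nat.card X * Nat.card B := by
  rw [Subgroup.card_eq_card_quotient_mul_card_subgroup (B.subgroupOf A)]
  refine Nat.mul_le_mul ?_ ?_
  · refine Nat.card_le_card_of_injective (fun y : A ⧸ B.subgroupOf A => f y.out) fun y z hyz => ?_
    rw [← QuotientGroup.out_eq' y, ← QuotientGroup.out_eq' z, QuotientGroup.eq]
    exact hf _ _ hyz
  · exact Nat.card_le_card_of_injective
      (fun x : B.subgroupOf A => (⟨x.1.1, x.2⟩ : B)) fun x y hxy =>
        Subtype.ext (Subtype.ext (Subtype.mk.inj hxy))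

theorem IsCyclic.card_pow_three_eq_one_le {Γ : Type*} [Group Γ] [Finite Γ] [IsCyclic Γ] :
    Nat.card {y : Γ // y ^ 3 = 1} ≤ 3 := by
  classical
  have := Fintype.ofFinite Γ
  rw [Nat.card_eq_fintype_card, Fintype.card_subtype]
  exact IsCyclic.card_pow_eq_one_le (by norm_num)

/-! ### Semilinear conjugation of matrices -/

open Matrix.GeneralLinearGroup in
theorem galoisActionGL_scalar {n : ℕ} {K : Type*} [Field K] (σ : RingAut K) (c : Kˣ) :
    galoisActionGL n K σ (scalar (Fin n) c) = scalar (Fin n) (Units.mapEquiv σ.toMulEquiv c) := by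
  ext i j
  by_cases h : i = j <;> simp [galoisActionGL, Matrix.diagonal, h]

open Matrix.GeneralLinearGroup in
theorem det_galoisActionGL {n : ℕ} {K : Type*} [Field K] (σ : RingAut K)
    (h : Matrix.GeneralLinearGroup (Fin n) K) :
    det (galoisActionGL n K σ h) = Units.mapEquiv σ.toMulEquiv (det h) := by
  ext
  simpa [galoisActionGL] using (RingHom.map_det (σ : K →+* K) h.1).symm

open Matrix.GeneralLinearGroup in
theorem scalar_injective {n : ℕ} [NeZero n] {K : Type*} [Field K] :
    Function.Injective (scalar (Fin n) : Kˣ → Matrix.GeneralLinearGroup (Fin n) K) := by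
  intro a b h
  ext
  have := congrArg (fun x : Matrix.GeneralLinearGroup (Fin n) K => x.1 0 0) h
  simpa using this

open Matrix.GeneralLinearGroup in
theorem coe_scalar_mul {n : ℕ} {K : Type*} [Field K] (c : Kˣ)
    (h : Matrix.GeneralLinearGroup (Fin n) K) :
    (scalar (Fin n) c * h).1 = (c : K) • h.1 := by
  rw [Units.val_mul, coe_scalar, Matrix.scalar_apply, ← Matrix.smul_eq_diagonal_mul]

/-- The semilinear automorphism `x ↦ g σ(x) g⁻¹` of the matrix algebra. -/
def twistedConj {n : ℕ} {K : Type*} [Field K] (g : Matrix.GeneralLinearGroup (Fin n) K)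
    (σ : RingAut K) : Matrix (Fin n) (Fin n) K →+ Matrix (Fin n) (Fin n) K where
  toFun x := g.1 * x.map σ * g⁻¹.1
  map_zero' := by simp
  map_add' x y := by rw [Matrix.map_add _ (map_add σ), mul_add, add_mul]

theorem twistedConj_smul {n : ℕ} {K : Type*} [Field K] (g : Matrix.GeneralLinearGroup (Fin n) K)
    (σ : RingAut K) (c : K) (x : Matrix (Fin n) (Fin n) K) :
    twistedConj g σ (c • x) = σ c • twistedConj g σ x := by
  change g.1 * (c • x).map σ * g⁻¹.1 = σ c • (g.1 * x.map σ * g⁻¹.1)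
  have : (c • x).map σ = σ c • x.map σ := by ext; simp
  rw [this, mul_smul_comm, smul_mul_assoc]

open Matrix.GeneralLinearGroup Module in
/-- A subgroup of `GL_n(K)` lying in a subspace of dimension `d`, all of whose elements have a
multiple fixed by `x ↦ g σ(x) g⁻¹`, has image of order at most `|F|^d / (|F| - 1)` modulo scalars,
where `F` is the fixed field of `σ`. -/
theorem card_mul_card_units_le {n : ℕ} {K : Type*} [Field K] [Finite K] (F : Subfield K)
    (σ : RingAut K) (hF : ∀ x, x ∈ F ↔ σ x = x) (g : Matrix.GeneralLinearGroup (Fin n) K)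
    (P : Subgroup (Matrix.GeneralLinearGroup (Fin n) K))
    (hP : ∀ h ∈ P, ∃ x : Kˣ, twistedConj g σ (scalar (Fin n) x * h).1 = (scalar (Fin n) x * h).1)
    (E : Submodule K (Matrix (Fin n) (Fin n) K)) (hE : ∀ h ∈ P, h.1 ∈ E) {d : ℕ}
    (hd : finrank K E ≤ d) :
    Nat.card P * Nat.card Fˣ ≤ Nat.card Kˣ * Nat.card F ^ d := by
  have hP' : ∀ h : P, ∃ x : Kˣ,
    twistedConj g σ (scalar (Fin n) x * h.1).1 = (scalar (Fin n) x * h.1).1 := fun h => hP h.1 h.2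
  choose x hx using hP'
  let S : Set (Matrix (Fin n) (Fin n) K) := {m | m ∈ E ∧ twistedConj g σ m = m}
  have hS : Nat.card S ≤ Nat.card F ^ d := by
    refine card_le_pow_of_semilinear_fixed F σ hF (twistedConj g σ) (twistedConj_smul g σ) S
      (fun m hm => hm.2) (le_trans (Submodule.finrank_mono ?_) hd)
    exact Submodule.span_le.mpr fun m hm => hm.1
  refine le_trans ?_ (Nat.mul_le_mul_left _ hS)
  rw [← Nat.card_prod, ← Nat.card_prod]
  let ι : Fˣ →* Kˣ := Units.map F.subtype
  have hι : Function.Injective ι := Units.map_injective F.subtype.injective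
  -- The second entry is the first entry times h, so the pair determines h, and then the unit of F.
  let f : P × Fˣ → Kˣ × S := fun p =>
    ⟨x p.1 * ι p.2, ⟨(p.2 : K) • (scalar (Fin n) (x p.1) * p.1.1).1, by
      refine ⟨E.smul_mem _ ?_, ?_⟩
      · rw [coe_scalar_mul]
        exact E.smul_mem _ (hE _ p.1.2)
      · rw [twistedConj_smul, hx, (hF _).mp p.2.1.2]⟩⟩
  refine Nat.card_le_card_of_injective f ?_
  rintro ⟨a, c⟩ ⟨b, e⟩ hab
  have h1 : x a * ι c = x b * ι e := congrArg Prod.fst hab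
  have h2 : (c : K) • (scalar (Fin n) (x a) * a.1).1 = (e : K) • (scalar (Fin n) (x b) * b.1).1 :=
    congrArg Subtype.val (congrArg Prod.snd hab)
  have h3 : a = b := by
    apply Subtype.ext
    apply Units.ext
    rw [coe_scalar_mul, coe_scalar_mul, smul_smul, smul_smul] at h2
    have h4 : (c : K) * (x a : K) = (e : K) * (x b : K) := by
      have := congrArg Units.val h1
      simpa [ι, mul_comm] using this
    rw [h4] at h2
    have h5 : (e : K) * (x b : K) ≠ 0 := by
      exact mul_ne_zero (by simp) (x b).ne_zero
    exact smul_right_injective _ h5 h2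
  subst h3
  rw [hι (mul_left_cancel h1)]

/-! ### The linear part -/

open Matrix.GeneralLinearGroup Module in
/-- A subgroup of `GL_3(K)` which is abelian modulo scalars and commutes modulo scalars with
`gσ` has image of order at most `9 |F|^3 / (|F| - 1)` modulo scalars, where `F` is the fixed field
of `σ`. -/
theorem card_mul_card_units_le_of_commute {K : Type*} [Field K] [Finite K] (F : Subfield K)
    (σ : RingAut K) (hF : ∀ x, x ∈ F ↔ σ x = x) (g : Matrix.GeneralLinearGroup (Fin 3) K)
    (P : Subgroup (Matrix.GeneralLinearGroup (Fin 3) K))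
    (hσ : ∀ h ∈ P, ∃ c : Kˣ, g * galoisActionGL 3 K σ h * g⁻¹ = scalar (Fin 3) c * h)
    (hcomm : ∀ h ∈ P, ∀ h' ∈ P, ∃ c : Kˣ, h * h' = scalar (Fin 3) c * (h' * h)) :
    Nat.card P * Nat.card Fˣ ≤ 9 * (Nat.card Kˣ * Nat.card F ^ 3) := by
  let sc := scalar (R := K) (Fin 3)
  let τ : MulAut (Matrix.GeneralLinearGroup (Fin 3) K) := MulAut.conj g * galoisActionGL 3 K σ
  let s : Kˣ ≃* Kˣ := Units.mapEquiv σ.toMulEquiv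
  have hscomm : ∀ c h, sc c * h = h * sc c := fun c h => scalar_commute c h
  have hτsc : ∀ c, τ (sc c) = sc (s c) := fun c => by
    change g * galoisActionGL 3 K σ (sc c) * g⁻¹ = _
    rw [galoisActionGL_scalar, mul_inv_eq_iff_eq_mul]
    exact (scalar_commute _ _).symm
  let Q : Subgroup (Matrix.GeneralLinearGroup (Fin 3) K) :=
    { carrier := {h | h ∈ P ∧ ∃ x, τ (sc x * h) = sc x * h}
      one_mem' := ⟨P.one_mem, 1, by simp⟩
      mul_mem' := by
        rintro a b ⟨ha, x, hx⟩ ⟨hb, y, hy⟩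
        have : sc (x * y) * (a * b) = (sc x * a) * (sc y * b) := by
          rw [map_mul, mul_assoc, ← mul_assoc (sc y), hscomm y a]; group
        exact ⟨P.mul_mem ha hb, x * y, by rw [this, map_mul, hx, hy]⟩
      inv_mem' := by
        rintro a ⟨ha, x, hx⟩
        have : sc x⁻¹ * a⁻¹ = (sc x * a)⁻¹ := by rw [hscomm x a, map_inv]; group
        exact ⟨P.inv_mem ha, x⁻¹, by rw [this, map_inv, hx]⟩ }
  have hPQ : Nat.card P ≤ 3 * Nat.card Q := by
    let δ : Kˣ →* Kˣ := s.toMonoidHom / MonoidHom.id Kˣ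
    have hδ : ∀ x, δ x = s x / x := fun x => rfl
    have hσ' : ∀ h : P, ∃ c : Kˣ, τ h.1 = sc c * h.1 := fun h => hσ h.1 h.2
    choose c hc using hσ'
    -- The determinant of τ(h) = c h gives c³ = s(det h)/det h. As Kˣ modulo the range of δ is
    -- cyclic, c has at most three classes there.
    have hc3 : ∀ h : P, (c h) ^ 3 ∈ δ.range := by
      intro h
      refine ⟨det h.1, ?_⟩
      have h1 := congrArg det (hc h)
      have h2 : det (τ h.1) = s (det h.1) := by
        change det (g * galoisActionGL 3 K σ h.1 * g⁻¹) = _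
        rw [map_mul, map_mul, det_galoisActionGL, map_inv, mul_inv_cancel_comm]
      rw [h2, map_mul, det_scalar, Fintype.card_fin] at h1
      rw [hδ, h1, mul_div_cancel_right]
    have : IsCyclic (Kˣ ⧸ δ.range) :=
      isCyclic_of_surjective (QuotientGroup.mk' δ.range) (QuotientGroup.mk'_surjective _)
    let f : P → {y : Kˣ ⧸ δ.range // y ^ 3 = 1} := fun h =>
      ⟨QuotientGroup.mk (c h), by
        rw [← QuotientGroup.mk_pow]; exact (QuotientGroup.eq_one_iff _).mpr (hc3 h)⟩
    refine (card_le_card_mul_of_fibers P Q f fun a b hab => ?_).trans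
      (Nat.mul_le_mul_right _ IsCyclic.card_pow_three_eq_one_le)
    obtain ⟨x, hx⟩ := QuotientGroup.eq.mp (congrArg Subtype.val hab)
    refine ⟨P.mul_mem (P.inv_mem a.2) b.2, x⁻¹, ?_⟩
    have h1 : τ (a.1⁻¹ * b.1) = sc (s x / x) * (a.1⁻¹ * b.1) := by
      rw [← hδ, hx, map_mul, map_inv, hc, hc, hscomm (c a), mul_inv_rev, map_mul, map_inv]
      simp only [mul_assoc]
      rw [← mul_assoc a.1⁻¹, ← hscomm (c b) a.1⁻¹, mul_assoc]
    rw [map_mul, hτsc, h1, ← mul_assoc, ← map_mul, map_inv]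
    congr 2
    rw [div_eq_mul_inv, inv_mul_cancel_left]
  have hfix : ∀ h ∈ Q, ∃ x : Kˣ, twistedConj g σ (sc x * h).1 = (sc x * h).1 := by
    rintro h ⟨-, x, hx⟩
    exact ⟨x, congrArg Units.val hx⟩
  by_cases hab : ∀ h ∈ Q, ∀ h' ∈ Q, h * h' = h' * h
  · let e : Matrix (Fin 3) (Fin 3) K ≃ₐ[K] Module.End K (Fin 3 → K) := Matrix.toLinAlgEquiv'
    let S : Set (Matrix (Fin 3) (Fin 3) K) := {m | ∃ h ∈ Q, h.1 = m}
    have hSc : ∀ a ∈ S, ∀ b ∈ S, a * b = b * a := by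
      rintro _ ⟨a, ha, rfl⟩ _ ⟨b, hb, rfl⟩
      exact congrArg Units.val (hab a ha b hb)
    let A := Algebra.adjoin K S
    have hA : finrank K A ≤ 3 := by
      have h1 := finrank_le_three_of_commute (K := K) (V := Fin 3 → K) (by simp)
        (A.map e.toAlgHom) ?_
      · rwa [← (A.equivMapOfInjective e.toAlgHom e.injective).toLinearEquiv.finrank_eq] at h1
      · rintro _ ⟨a, ha, rfl⟩ _ ⟨b, hb, rfl⟩
        have : Commute a b := by
          refine Algebra.commute_of_mem_adjoin_of_forall_mem_commute hb fun b' hb' => ?_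
          exact (Algebra.commute_of_mem_adjoin_of_forall_mem_commute ha fun a' ha' =>
            hSc b' hb' a' ha').symm
        exact this.map e.toAlgHom
    have h2 := card_mul_card_units_le F σ hF g Q hfix (Subalgebra.toSubmodule A)
      (fun h hh => Algebra.subset_adjoin ⟨h, hh, rfl⟩) hA
    calc Nat.card P * Nat.card Fˣ ≤ 3 * (Nat.card Q * Nat.card Fˣ) := by
          rw [← mul_assoc]; exact Nat.mul_le_mul_right _ hPQ
      _ ≤ _ := Nat.mul_le_mul (by norm_num) h2
  · push Not at hab
    obtain ⟨a, ha, b, hb, hne⟩ := hab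
    have hac : ∀ x : Q, ∃ c : Kˣ, a * x.1 = sc c * (x.1 * a) := fun x => hcomm a ha.1 x.1 x.2.1
    have hc3 : ∀ (x : Q) (c : Kˣ), a * x.1 = sc c * (x.1 * a) → c ^ 3 = 1 := by
      intro x c hc
      have h1 := congrArg det hc
      rw [map_mul, map_mul, map_mul, det_scalar, Fintype.card_fin, mul_comm (det x.1)] at h1
      exact (mul_eq_right.mp h1.symm)
    -- The commutator scalar with a is a cube root of unity, and elements of Q sharing it differ by
    -- an element commuting with a.
    let R := Q ⊓ Subgroup.centralizer {a}
    choose c hc using hac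
    have hQR : Nat.card Q ≤ 3 * Nat.card R := by
      let f : Q → {y : Kˣ // y ^ 3 = 1} := fun x => ⟨c x, hc3 x _ (hc x)⟩
      refine (card_le_card_mul_of_fibers Q R f fun x y hxy => ?_).trans
        (Nat.mul_le_mul_right _ IsCyclic.card_pow_three_eq_one_le)
      refine ⟨Q.mul_mem (Q.inv_mem x.2) y.2, ?_⟩
      refine Subgroup.mem_centralizer_singleton_iff.mpr ?_
      have h1 : c x = c y := congrArg Subtype.val hxy
      have h2 : x.1⁻¹ * a = sc (c x) * a * x.1⁻¹ := by
        rw [eq_mul_inv_iff_mul_eq, mul_assoc, hc x, hscomm, inv_mul_eq_iff_eq_mul, hscomm, mul_assoc]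
      have h3 : y.1 * a = (sc (c x))⁻¹ * (a * y.1) := by
        rw [hc y, h1, inv_mul_cancel_left]
      rw [mul_assoc, h3, ← map_inv, ← mul_assoc, ← hscomm, mul_assoc, ← mul_assoc x.1⁻¹, h2,
        map_inv]
      group
    obtain ⟨cb, hcb⟩ := hcomm a ha.1 b hb.1
    have hcb1 : (cb : K) ≠ 1 := by
      intro h
      rw [Units.val_eq_one] at h
      rw [h, map_one, one_mul] at hcb
      exact hne hcb
    have hdim := finrank_centralizer_le_three a.1 b.1 a.isUnit b.isUnit hcb1 (by
      rw [← Units.val_mul, hcb, coe_scalar_mul, Units.val_mul])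
    have h2 := card_mul_card_units_le F σ hF g R (fun h hh => hfix h hh.1)
      (Subalgebra.toSubmodule (Subalgebra.centralizer K {a.1})) (fun h hh => by
        have h1 := Subgroup.mem_centralizer_singleton_iff.mp hh.2
        rw [Subalgebra.mem_toSubmodule, Subalgebra.mem_centralizer_iff]
        rintro _ rfl
        exact congrArg Units.val h1.symm) hdim
    calc Nat.card P * Nat.card Fˣ ≤ 9 * (Nat.card R * Nat.card Fˣ) := by
          rw [← mul_assoc]; exact Nat.mul_le_mul_right _ (by omega)
      _ ≤ _ := Nat.mul_le_mul_left _ h2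

/-! ### Galois groups and the projection from PΓL -/

/-- By Artin's theorem Γ is the full Galois group of K over its fixed field, hence cyclic. -/
theorem isCyclic_subgroup_ringAut {K : Type*} [Field K] [Finite K] (Γ : Subgroup (RingAut K)) :
    IsCyclic Γ := by
  have : Finite (RingAut K) := DFunLike.finite (RingAut K)
  exact isCyclic_of_injective (FixedPoints.toAlgAutMulEquiv Γ K).toMonoidHom
    (FixedPoints.toAlgAutMulEquiv Γ K).injective

theorem card_eq_card_fixedPoints_pow {K : Type*} [Field K] [Finite K] (Γ : Subgroup (RingAut K)) :
    Nat.card K = Nat.card (FixedPoints.subfield Γ K) ^ Nat.card Γ := by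
  have : Finite (RingAut K) := DFunLike.finite (RingAut K)
  have := Fintype.ofFinite Γ
  rw [Nat.card_eq_fintype_card (α := Γ), ← FixedPoints.finrank_eq_card Γ K]
  exact Module.natCard_eq_pow_finrank

/-- The homomorphism from `PΓL_n(K)` to the group of automorphisms of `K`. -/
def PGammaL.toRingAut (n : ℕ) (K : Type*) [Field K] : PGammaL n K →* RingAut K :=
  QuotientGroup.lift (scalarSubgroup n K) SemidirectProduct.rightHom (by
    rintro _ ⟨z, -, rfl⟩
    simp)

theorem PGammaL.ker_toRingAut (n : ℕ) (K : Type*) [Field K] :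
    (PGammaL.toRingAut n K).ker = projectiveLinearSubgroup n K := by
  ext a
  obtain ⟨x, rfl⟩ := QuotientGroup.mk'_surjective _ a
  constructor
  · intro h
    have h' : x.right = 1 := h
    exact ⟨x.left, congrArg _ (SemidirectProduct.ext (by simp) (by simp [h']))⟩
  · rintro ⟨y, hy⟩
    rw [← hy]
    exact SemidirectProduct.right_inl (φ := galoisActionGL n K) y

open Matrix.GeneralLinearGroup in
theorem mk_eq_mk_iff_exists_scalar {n : ℕ} {K : Type*} [Field K] (x y : GammaL n K) :
    (QuotientGroup.mk' (scalarSubgroup n K) x = QuotientGroup.mk' (scalarSubgroup n K) y) ↔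
      ∃ c : Kˣ, y = SemidirectProduct.inl (scalar (Fin n) c) * x := by
  rw [eq_comm, QuotientGroup.mk'_apply, QuotientGroup.mk'_apply, QuotientGroup.eq_iff_div_mem]
  constructor
  · rintro ⟨z, hz, hzy⟩
    rw [SetLike.mem_coe, center_eq_range_scalar] at hz
    obtain ⟨c, rfl⟩ := hz
    exact ⟨c, by rw [hzy, div_mul_cancel]⟩
  · rintro ⟨c, rfl⟩
    rw [mul_div_cancel_right]
    exact ⟨_, by rw [SetLike.mem_coe, center_eq_range_scalar]; exact ⟨c, rfl⟩, rfl⟩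

-- Each class has at least |Kˣ| preimages in GL_3: the scalar multiples of one lift.
open Matrix.GeneralLinearGroup in
theorem card_inf_projectiveLinearSubgroup_mul_le {K : Type*} [Field K] [Finite K]
    (G : Subgroup (PGammaL 3 K)) :
    Nat.card ↑(G ⊓ projectiveLinearSubgroup 3 K) * Nat.card Kˣ ≤
      Nat.card (G.comap ((QuotientGroup.mk' (scalarSubgroup 3 K)).comp SemidirectProduct.inl)) := by
  have hlift : ∀ a : ↑(G ⊓ projectiveLinearSubgroup 3 K),
      ∃ x, QuotientGroup.mk' (scalarSubgroup 3 K) (SemidirectProduct.inl x) = a.1 := fun a => a.2.2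
  choose l hl using hlift
  rw [← Nat.card_prod]
  have hsc : ∀ (c : Kˣ) x, QuotientGroup.mk' (scalarSubgroup 3 K)
      (SemidirectProduct.inl (scalar (Fin 3) c * x)) =
        QuotientGroup.mk' (scalarSubgroup 3 K) (SemidirectProduct.inl x) := fun c x =>
    ((mk_eq_mk_iff_exists_scalar _ _).mpr ⟨c, map_mul _ _ _⟩).symm
  refine Nat.card_le_card_of_injective
    (fun p => ⟨scalar (Fin 3) p.2 * l p.1, ?_⟩) ?_
  · change QuotientGroup.mk' _ _ ∈ G
    rw [hsc, hl]
    exact p.1.2.1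
  · rintro ⟨a, c⟩ ⟨b, e⟩ hab
    have h1 : scalar (Fin 3) c * l a = scalar (Fin 3) e * l b := congrArg Subtype.val hab
    have h2 : a = b := by
      apply Subtype.ext
      rw [← hl a, ← hl b, ← hsc c, h1, hsc]
    subst h2
    rw [scalar_injective (mul_right_cancel h1)]

/-! ### The bound for G -/

open Matrix.GeneralLinearGroup in
theorem card_le_of_commute_of_not_le {K : Type*} [Field K] [Finite K] (G : Subgroup (PGammaL 3 K))
    (hG : ∀ a ∈ G, ∀ b ∈ G, a * b = b * a) (hG' : ¬ G ≤ projectiveLinearSubgroup 3 K) :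
    Nat.card G ≤ 36 * Nat.card K := by
  have hfin : Finite (RingAut K) := DFunLike.finite (RingAut K)
  let π := PGammaL.toRingAut 3 K
  let Γ := G.map π
  have hcardG : Nat.card G = Nat.card Γ * Nat.card ↑(G ⊓ projectiveLinearSubgroup 3 K) := by
    rw [← PGammaL.ker_toRingAut, ← Subgroup.relIndex_ker, inf_comm, ← Subgroup.inf_relIndex_right,
      mul_comm, ← Subgroup.relIndex_bot_left G, ← Subgroup.relIndex_bot_left (_ ⊓ _)]
    exact (Subgroup.relIndex_mul_relIndex _ _ _ bot_le inf_le_right).symm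
  obtain ⟨⟨σ, hσΓ⟩, hσ⟩ := (isCyclic_subgroup_ringAut Γ).exists_generator
  obtain ⟨φ, hφ, hφσ⟩ := id hσΓ
  obtain ⟨⟨g, σ'⟩, rfl⟩ := QuotientGroup.mk'_surjective _ φ
  obtain rfl : σ' = σ := hφσ
  let F := FixedPoints.subfield Γ K
  have hF : ∀ x, x ∈ F ↔ σ' x = x := by
    intro x
    refine ⟨fun h => h ⟨σ', hσΓ⟩, fun h γ => ?_⟩
    have hle : Subgroup.zpowers (⟨σ', hσΓ⟩ : Γ) ≤ MulAction.stabilizer Γ x := by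
      rw [Subgroup.zpowers_le]; exact h
    exact hle (hσ γ)
  have hΓ : 2 ≤ Nat.card Γ := by
    by_contra hlt
    have : Nat.card Γ = 1 := by have := Nat.card_pos (α := Γ); omega
    have h1 : Γ = ⊥ := Subgroup.card_eq_one.mp this
    rw [Subgroup.map_eq_bot_iff, PGammaL.ker_toRingAut] at h1
    exact hG' h1
  have hq : Nat.card K = Nat.card F ^ Nat.card Γ := card_eq_card_fixedPoints_pow Γ
  have hH := card_inf_projectiveLinearSubgroup_mul_le G
  have hP := card_mul_card_units_le_of_commute F σ' hF g
    (G.comap ((QuotientGroup.mk' (scalarSubgroup 3 K)).comp SemidirectProduct.inl)) ?_ ?_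
  · set H := Nat.card ↑(G ⊓ projectiveLinearSubgroup 3 K)
    set r := Nat.card Γ
    have hKu : 0 < Nat.card Kˣ := Nat.card_pos
    have h1 : H * Nat.card Fˣ ≤ 9 * Nat.card F ^ 3 := by
      refine Nat.le_of_mul_le_mul_left ?_ hKu
      calc Nat.card Kˣ * (H * Nat.card Fˣ) = (H * Nat.card Kˣ) * Nat.card Fˣ := by ring
        _ ≤ _ := Nat.mul_le_mul_right _ hH
        _ ≤ _ := hP
        _ = _ := by ring
    have hF2 : 2 ≤ Nat.card F := Finite.one_lt_card
    have hFu : Nat.card F ≤ 2 * Nat.card Fˣ := by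
      rw [Nat.card_units]; omega
    have h2 : H ≤ 18 * Nat.card F ^ 2 := by
      refine Nat.le_of_mul_le_mul_left (c := Nat.card F) ?_ (by omega)
      calc Nat.card F * H ≤ 2 * Nat.card Fˣ * H := Nat.mul_le_mul_right _ hFu
        _ = 2 * (H * Nat.card Fˣ) := by ring
        _ ≤ 2 * (9 * Nat.card F ^ 3) := Nat.mul_le_mul_left _ h1
        _ = _ := by ring
    -- r ≥ 2 leaves room for the factor |F|² in q = |F|^(t+2); the remaining |F|^t absorbs r = t + 2
    -- up to a factor 2.
    obtain ⟨t, ht⟩ := Nat.exists_eq_add_of_le hΓ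
    have h3 : r ≤ 2 * Nat.card F ^ t := by
      have h4 : t < 2 ^ t := Nat.lt_two_pow_self
      have h5 : 2 ^ t ≤ Nat.card F ^ t := Nat.pow_le_pow_left hF2 t
      omega
    rw [hcardG, hq]
    calc r * H ≤ (2 * Nat.card F ^ t) * (18 * Nat.card F ^ 2) := Nat.mul_le_mul h3 h2
      _ = 36 * Nat.card F ^ r := by rw [ht]; ring
  · intro h hh
    have h1 := hG _ hh _ hφ
    obtain ⟨c, hc⟩ := (mk_eq_mk_iff_exists_scalar (SemidirectProduct.inl h * ⟨g, σ'⟩)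
      (⟨g, σ'⟩ * SemidirectProduct.inl h)).mp h1
    refine ⟨c, ?_⟩
    have h2 := congrArg SemidirectProduct.left hc
    simp only [SemidirectProduct.mul_left, SemidirectProduct.left_inl, SemidirectProduct.right_inl,
      map_one, MulAut.one_apply] at h2
    rw [h2]
    group
  · intro h hh h' hh'
    have h1 := hG _ hh' _ hh
    obtain ⟨c, hc⟩ := (mk_eq_mk_iff_exists_scalar (SemidirectProduct.inl h' * SemidirectProduct.inl h)
      (SemidirectProduct.inl h * SemidirectProduct.inl h')).mp h1
    exact ⟨c, SemidirectProduct.inl_injective (by simpa only [map_mul] using hc)⟩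

theorem proposition3p2 :
    ∃ C : ℝ, ∀ (K : Type*) [Field K] [Finite K] (G : Subgroup (PGammaL 3 K)),
      (∀ a ∈ G, ∀ b ∈ G, a * b = b * a) →
      ¬ G ≤ projectiveLinearSubgroup 3 K →
      (Nat.card G : ℝ) ≤ C * (Nat.card K : ℝ) :=
  ⟨36, fun K _ _ G hG hG' => by exact_mod_cast card_le_of_commute_of_not_le G hG hG'⟩
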